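/- For $Z\subseteq\mathbb N$ let $\underline\rho(Z)=\liminf_n |Z\cap[0,n)|/n$ be its lower density. For infinite binary sequences $A,B\in 2^{\omega}$ let $A\leftrightarrow B$ be the set of $n$ with $A(n)=B(n)$, and put $$\gamma(A)=\sup_{X\in 2^\omega \text{ computable}}\underline\rho(A\leftrightarrow X),\qquad \Gamma(A)=\inf\{\gamma(Y): Y\in 2^\omega,\ Y\le_T A\}.$$ A function $f:\mathbb N\to\mathbb N$ is called $2^{(2^n)}$-infinitely often equal if $f(n)<2^{(2^n)}$ for all $n$ and, for every computable $g:\mathbb N\to\mathbb N$ with $g(n)<2^{(2^n)}$ for all $n$, there are infinitely many $n$ with $f(n)=g(n)$. Theorem. Let $1/2<\alpha<1$ and let $X\in 2^\omega$. If $\Gamma(X)<1-\alpha$, then $X$ computes a function that is $2^{(2^n)}$-infinitely often equal, and $\Gamma(X)=0$. Consequently, for every $X\in 2^\omega$ the value $\Gamma(X)$ is one of $0$, $1/2$, $1$. -/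

import Mathlib

open Filter

/-- The oracle given by an infinite binary sequence `A` (a subset of `ℕ`): its characteristic
function, with values `0` and `1`. -/
def seqOracle (A : ℕ → Bool) : ℕ →. ℕ := fun n => Part.some (A n).toNat

/-- The sequence `X` computes the total function `f`, that is `f ≤_T X`. -/
def Computes {σ : Type*} [Primcodable σ] (X : ℕ → Bool) (f : ℕ → σ) : Prop :=
  ComputableIn {seqOracle X} f

/-- The lower density `liminf_n |Z ∩ [0, n)| / n` of a set of natural numbers. -/
noncomputable def lowerDensity (Z : Set ℕ) : ℝ :=
  liminf (fun n : ℕ => ((Z ∩ Set.Iio n).ncard : ℝ) / (n : ℝ)) atTop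

/-- `A ↔ B`: the set of positions at which two sequences agree. -/
def agreement (A B : ℕ → Bool) : Set ℕ := {n | A n = B n}

/-- `γ(A)`: the supremum, over the computable sequences `X`, of the lower density of `A ↔ X`. -/
noncomputable def gammaValue (A : ℕ → Bool) : ℝ :=
  sSup {r : ℝ | ∃ X : ℕ → Bool, Computable X ∧ r = lowerDensity (agreement A X)}

/-- `Γ(A)`: the infimum of `γ(Y)` over the sequences `Y ≤_T A`. -/
noncomputable def GammaValue (A : ℕ → Bool) : ℝ :=
  sInf {r : ℝ | ∃ Y : ℕ → Bool, Computes A Y ∧ r = gammaValue Y}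

/-- `f` is `h`-infinitely often equal: it is bounded by `h`, and it agrees at infinitely many
arguments with every computable function that is bounded by `h`. -/
def InfinitelyOftenEqual (h f : ℕ → ℕ) : Prop :=
  (∀ n, f n < h n) ∧
    ∀ g : ℕ → ℕ, Computable g → (∀ n, g n < h n) → ∃ᶠ n in atTop, f n = g n

/-!
The heart of the matter is that `Γ(X) < 1 / 2` forces `X` to compute an infinitely often equal
function, which is a matter of error-correcting codes. If `X` computes `Y` with `γ(Y) < 1 / 2`,
then, by passing from computable sequences to their complements, every computable sequence agrees
with `Y` on more than the fraction `1 / 2 + 3 / p` of infinitely many initial segments, for a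
suitable `p`. Cut the positions into blocks whose lengths grow geometrically with ratio close to
`1`; then every computable sequence agrees with `Y` on the fraction `1 / 2 + 1 / p` of infinitely
many blocks (`frequently_blockAgree`). There are computable binary codes of positive rate for
which at most a bounded number `L` of codewords agree with a given word on such a fraction
(`exists_listDecodable`: a greedy code whose words pairwise agree on little more than half, by the
Chernoff bound, and the Cauchy–Schwarz inequality for the size of the lists). Encoding the values
of a computable function `g` by codewords, one finds that `g k` is infinitely often one of the at
most `L` messages decoded from the `k`-th block of `Y`. Reading messages as `L`-tuples, the `i`-th
entry of the `i`-th message in the list is infinitely often equal for some `i`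
(`exists_infinitelyOftenEqual_of_trace`). The bound obtained is doubly exponential, and splitting
the arguments into residue classes changes it to any other doubly exponential bound
(`exists_infinitelyOftenEqual_of_le`).

Conversely, with the bound `2 ^ (K ^ n)` an infinitely often equal function codes a sequence whose
complement disagrees with each computable sequence on infinitely many whole blocks, where the
positions before a block make up at most the fraction `1 / K` of those up to its end; hence
`Γ(X) ≤ 1 / K` for every `K` (`GammaValue_eq_zero`).

For the trichotomy it remains that `Γ(X) ≤ 1 / 2` if `X` is not computable. The same codes are
used: the concatenation of the codewords of the initial segments of `X`, on rapidly growing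
blocks, has `γ`-value at most `1 / 2 + 2 / p`, since otherwise list decoding would give a
computable trace of bounded size for `X`, and then `X` would be computable
(`computable_of_trace`).
-/

/-! ### Relative computability -/

section RelativeComputability

variable {α β γ σ : Type*} [Primcodable α] [Primcodable β] [Primcodable γ] [Primcodable σ]
  {O : Set (ℕ →. ℕ)}

theorem ComputableIn.comp {f : β → σ} {g : α → β} (hf : ComputableIn O f)
    (hg : ComputableIn O g) : ComputableIn O fun a => f (g a) := by
  refine (Nat.RecursiveIn.comp hf hg).of_eq fun n => ?_
  cases (Encodable.decode n : Option α) <;> simp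

theorem ComputableIn.pair {f : α → β} {g : α → γ} (hf : ComputableIn O f)
    (hg : ComputableIn O g) : ComputableIn O fun a => (f a, g a) := by
  refine (Nat.RecursiveIn.pair hf hg).of_eq fun n => ?_
  cases (Encodable.decode n : Option α) <;> simp [Seq.seq]

theorem Computable.compIn {f : β → σ} {g : α → β} (hf : Computable f)
    (hg : ComputableIn O g) : ComputableIn O fun a => f (g a) :=
  hf.computableIn.comp hg

theorem Computable₂.compIn {f : β → γ → σ} {g : α → β} {h : α → γ} (hf : Computable₂ f)
    (hg : ComputableIn O g) (hh : ComputableIn O h) : ComputableIn O fun a => f (g a) (h a) :=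
  hf.computableIn.comp (hg.pair hh)

/-- Primitive recursion relative to a set of oracles. -/
theorem ComputableIn.natRec {h : ℕ → ℕ → ℕ} (a : ℕ) (hh : ComputableIn₂ O h) :
    ComputableIn O fun n => (Nat.rec a h n : ℕ) := by
  have hh' : ComputableIn O fun p : ℕ × ℕ × ℕ => h p.2.1 p.2.2 :=
    ComputableIn.comp (f := fun p : ℕ × ℕ => h p.1 p.2) hh .snd
  have key := Nat.RecursiveIn.prec (O := O) (f := fun _ => Part.some a)
    (RecursiveIn.iff_nat.1 (ComputableIn.const (α := ℕ) a)) hh'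
  have hpair : Nat.RecursiveIn O fun n : ℕ => Part.some (Nat.pair 0 n) :=
    RecursiveIn.iff_nat.1
      ((Primrec₂.natPair.comp (.const 0) .id).computableIn (O := O) : ComputableIn O _)
  refine RecursiveIn.iff_nat.2 ((key.comp hpair).of_eq fun n => ?_)
  simp only [Part.bind_eq_bind, Part.bind_some, Nat.unpair_pair]
  induction n with
  | zero => rfl
  | succ n ih =>
    simp only [ih]
    simp

theorem computableIn_empty_iff {f : α → σ} : ComputableIn ∅ f ↔ Computable f :=
  recursiveIn_empty_iff

end RelativeComputability

/-! ### Bounded and unbounded search -/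

section Search

variable {α β : Type*} [Primcodable α] [Primcodable β]

theorem Computable.decideEq {f g : α → ℕ} (hf : Computable f) (hg : Computable g) :
    Computable fun a => decide (f a = g a) :=
  (Primrec.eq (α := ℕ)).decide.to_comp.comp hf hg

theorem Computable.decideLE {f g : α → ℕ} (hf : Computable f) (hg : Computable g) :
    Computable fun a => decide (f a ≤ g a) :=
  Primrec.nat_le.decide.to_comp.comp hf hg

theorem Computable.filterRange {p : α → ℕ → Bool} (hp : Computable₂ p) :
    Computable₂ fun a n => (List.range n).filter (p a) := by
  have h : Computable₂ fun (x : α × ℕ) (y : ℕ × List ℕ) =>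
      bif p x.1 y.1 then y.2 ++ [y.1] else y.2 := by
    have h1 : Computable fun z : (α × ℕ) × (ℕ × List ℕ) => z.1.1 := Computable.fst.comp .fst
    have h2 : Computable fun z : (α × ℕ) × (ℕ × List ℕ) => z.2.1 := Computable.fst.comp .snd
    have h3 : Computable fun z : (α × ℕ) × (ℕ × List ℕ) => z.2.2 := Computable.snd.comp .snd
    exact Computable.cond (hp.comp h1 h2) (Computable.list_concat.comp h3 h2) h3
  refine (Computable.nat_rec (f := fun x : α × ℕ => x.2) .snd (.const []) h).of_eq ?_
  rintro ⟨a, n⟩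
  induction n with
  | zero => rfl
  | succ n ih =>
    simp only at ih ⊢
    rw [ih, List.range_succ, List.filter_append]
    cases hpn : p a n <;> simp [hpn]

theorem Computable.forallLt {p : α → ℕ → Bool} (hp : Computable₂ p) {n : α → ℕ}
    (hn : Computable n) : Computable fun a => decide (∀ i < n a, p a i = true) := by
  have hnot : Computable₂ fun a i => !p a i := Primrec.not.to_comp.comp hp
  have := Computable.decideEq
    (Computable.list_length.comp ((Computable.filterRange hnot).comp .id hn)) (.const 0)
  refine this.of_eq fun a => ?_
  simp [List.filter_eq_nil_iff]

theorem Computable.exists_search [Inhabited β] {p : α → β → Bool} (hp : Computable₂ p)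
    (h : ∀ a, ∃ b, p a b = true) : ∃ f : α → β, Computable f ∧ ∀ a, p a (f a) = true := by
  have hd : Computable fun n : ℕ => ((Encodable.decode n : Option β).getD default) :=
    Computable.option_getD .decode (.const default)
  have hp' : Computable₂ fun (a : α) (n : ℕ) =>
      p a ((Encodable.decode n : Option β).getD default) :=
    hp.comp .fst (hd.comp .snd)
  have hr : Partrec fun a => Nat.rfind fun n =>
      (Part.some (p a ((Encodable.decode n : Option β).getD default)) : Part Bool) :=
    Partrec.rfind hp'.partrec₂
  have hdom : ∀ a, (Nat.rfind fun n =>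
      (Part.some (p a ((Encodable.decode n : Option β).getD default)) : Part Bool)).Dom := by
    intro a
    obtain ⟨b, hb⟩ := h a
    refine Nat.rfind_dom.2 ⟨Encodable.encode b, ?_, fun _ => trivial⟩
    simp [hb]
  refine ⟨fun a => (Encodable.decode ((Nat.rfind _).get (hdom a)) : Option β).getD default,
    hd.comp (hr.of_eq_tot fun a => Part.get_mem (hdom a)), fun a => ?_⟩
  have := Nat.rfind_spec (Part.get_mem (hdom a))
  simpa using this

/-- Finitely many computable functions are uniformly computable. -/
theorem exists_computable₂_of_forall {g : ℕ → ℕ → ℕ} (hg : ∀ i, Computable (g i)) (a : ℕ) :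
    ∃ G : ℕ → ℕ → ℕ, Computable₂ G ∧ ∀ i < a, G i = g i := by
  induction a with
  | zero => exact ⟨fun _ _ => 0, .const 0, by simp⟩
  | succ a ih =>
    obtain ⟨G, hG, hGg⟩ := ih
    refine ⟨fun i n => cond (decide (i = a)) (g a n) (G i n),
      Computable.cond (Computable.decideEq .fst (.const a)) ((hg a).comp .snd) hG, ?_⟩
    intro i hi
    ext n
    rcases Nat.lt_succ_iff_lt_or_eq.1 hi with h | rfl
    · simp [h.ne, hGg i h]
    · simp

end Search

theorem computable_pow : Computable₂ fun a b : ℕ => a ^ b :=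
  (Primrec₂.unpaired'.1 Nat.Primrec.pow).to_comp

theorem computable_testBit : Computable₂ Nat.testBit := by
  have : Computable fun p : ℕ × ℕ => decide (p.1 / 2 ^ p.2 % 2 = 1) :=
    Computable.decideEq (Primrec.nat_mod.to_comp.comp
      (Primrec.nat_div.to_comp.comp .fst (computable_pow.comp (.const 2) .snd)) (.const 2))
      (.const 1)
  refine this.of_eq fun p => ?_
  simp [Nat.testBit_eq_decide_div_mod_eq]

/-! ### Initial segments and blocks of binary sequences -/

/-- The initial segment of length `n` of a binary sequence, as the number whose binary digits
it lists, least significant digit first. -/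
def prefixCode (Y : ℕ → Bool) (n : ℕ) : ℕ :=
  Nat.rec 0 (fun k c => c + (Y k).toNat * 2 ^ k) n

theorem prefixCode_succ (Y : ℕ → Bool) (n : ℕ) :
    prefixCode Y (n + 1) = prefixCode Y n + (Y n).toNat * 2 ^ n := rfl

theorem prefixCode_lt (Y : ℕ → Bool) (n : ℕ) : prefixCode Y n < 2 ^ n := by
  induction n with
  | zero => simp [prefixCode]
  | succ n ih =>
    rw [prefixCode_succ, pow_succ]
    cases Y n <;> simp <;> omega

theorem testBit_prefixCode (Y : ℕ → Bool) {n i : ℕ} (hi : i < n) :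
    (prefixCode Y n).testBit i = Y i := by
  induction n with
  | zero => omega
  | succ n ih =>
    rw [prefixCode_succ, add_comm]
    have hlt := prefixCode_lt Y n
    rcases Nat.lt_succ_iff_lt_or_eq.1 hi with h | rfl
    · cases Y n
      · simp [ih h]
      · simp [Nat.testBit_two_pow_add_gt h, ih h]
    · cases hY : Y i
      · simp [Nat.testBit_lt_two_pow hlt]
      · simp [Nat.testBit_two_pow_add_eq, Nat.testBit_lt_two_pow hlt]

theorem computableIn_prefixCode {O : Set (ℕ →. ℕ)} {Y : ℕ → Bool} (hY : ComputableIn O Y) :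
    ComputableIn O (prefixCode Y) := by
  refine ComputableIn.natRec 0 ?_
  have h1 : ComputableIn O fun p : ℕ × ℕ => (Y p.1).toNat :=
    (Primrec.dom_bool Bool.toNat).to_comp.compIn (hY.comp .fst)
  have h2 : ComputableIn O fun p : ℕ × ℕ => 2 ^ p.1 :=
    computable_pow.compIn (.const 2) .fst
  exact Primrec.nat_add.to_comp.compIn .snd (Primrec.nat_mul.to_comp.compIn h1 h2)

/-- The restriction of `Y` to the `k`-th of the blocks `[b k, b (k + 1))`, as the number whose
binary digits it lists, least significant digit first. -/
def blockCode (b : ℕ → ℕ) (Y : ℕ → Bool) (k : ℕ) : ℕ :=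
  prefixCode Y (b (k + 1)) / 2 ^ b k

theorem blockCode_lt {b : ℕ → ℕ} (hb : StrictMono b) (Y : ℕ → Bool) (k : ℕ) :
    blockCode b Y k < 2 ^ (b (k + 1) - b k) := by
  rw [blockCode, Nat.div_lt_iff_lt_mul (by positivity), ← pow_add,
    Nat.sub_add_cancel (hb (Nat.lt_succ_self k)).le]
  exact prefixCode_lt _ _

theorem testBit_blockCode {b : ℕ → ℕ} (Y : ℕ → Bool) {k i : ℕ} (hi : i < b (k + 1) - b k) :
    (blockCode b Y k).testBit i = Y (b k + i) := by
  rw [blockCode, Nat.testBit_div_two_pow, testBit_prefixCode _ (by omega), add_comm]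

theorem computableIn_blockCode {O : Set (ℕ →. ℕ)} {b : ℕ → ℕ} (hb : Computable b)
    {Y : ℕ → Bool} (hY : ComputableIn O Y) : ComputableIn O (blockCode b Y) :=
  Primrec.nat_div.to_comp.compIn
    ((computableIn_prefixCode hY).comp (hb.comp .succ).computableIn)
    (computable_pow.compIn (.const 2) hb.computableIn)

theorem computable_blockLength {b : ℕ → ℕ} (hb : Computable b) :
    Computable fun k => b (k + 1) - b k :=
  Primrec.nat_sub.to_comp.comp (hb.comp .succ) hb

theorem exists_computable_blockIndex {b : ℕ → ℕ} (hb : Computable b) (hmono : StrictMono b)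
    (h0 : b 0 = 0) :
    ∃ J : ℕ → ℕ, Computable J ∧ ∀ k n, b k ≤ n → n < b (k + 1) → J n = k := by
  have hp : Computable₂ fun n k => decide (b k ≤ n) && decide (n + 1 ≤ b (k + 1)) :=
    Primrec.and.to_comp.comp (Computable.decideLE (hb.comp .snd) .fst)
      (Computable.decideLE (Computable.succ.comp .fst) (hb.comp (Computable.succ.comp .snd)))
  obtain ⟨J, hJ, hJs⟩ := Computable.exists_search hp (fun n => by
    refine ⟨Nat.findGreatest (fun k => b k ≤ n) n, ?_⟩
    have h1 : b (Nat.findGreatest (fun k => b k ≤ n) n) ≤ n :=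
      Nat.findGreatest_spec (P := fun k => b k ≤ n) (Nat.zero_le n) (by simp [h0])
    have h2 : n < b (Nat.findGreatest (fun k => b k ≤ n) n + 1) := by
      by_contra! h
      have hle : Nat.findGreatest (fun k => b k ≤ n) n + 1 ≤ n := hmono.le_apply.trans h
      have := Nat.le_findGreatest (P := fun k => b k ≤ n) hle h
      omega
    simpa using ⟨h1, h2⟩)
  refine ⟨J, hJ, fun k n h1 h2 => ?_⟩
  have hs := hJs n
  simp only [Bool.and_eq_true, decide_eq_true_eq] at hs
  have e1 := hmono.lt_iff_lt.1 (hs.1.trans_lt h2)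
  have e2 := hmono.lt_iff_lt.1 (h1.trans_lt (Nat.lt_of_succ_le hs.2))
  omega

/-- The concatenation of blocks given by the binary digits of numbers `w k` is computable
from `w`. -/
theorem exists_concat {O : Set (ℕ →. ℕ)} {b : ℕ → ℕ} (hb : Computable b) (hmono : StrictMono b)
    (h0 : b 0 = 0) {w : ℕ → ℕ} (hw : ComputableIn O w) :
    ∃ Z : ℕ → Bool, ComputableIn O Z ∧
      ∀ k i, i < b (k + 1) - b k → Z (b k + i) = (w k).testBit i := by
  obtain ⟨J, hJ, hJs⟩ := exists_computable_blockIndex hb hmono h0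
  refine ⟨fun n => (w (J n)).testBit (n - b (J n)), ?_, fun k i hi => ?_⟩
  · exact computable_testBit.compIn (hw.comp hJ.computableIn)
      (Primrec.nat_sub.to_comp.comp .id (hb.comp hJ)).computableIn
  · simp [hJs k (b k + i) (by omega) (by omega)]

/-! ### Counting agreements -/

/-- The number of positions below `n` at which two binary sequences agree. -/
def agreeCount (Y Z : ℕ → Bool) (n : ℕ) : ℕ := Nat.count (fun i => Y i = Z i) n

theorem agreeCount_succ (Y Z : ℕ → Bool) (n : ℕ) :
    agreeCount Y Z (n + 1) = agreeCount Y Z n + if Y n = Z n then 1 else 0 :=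
  Nat.count_succ _ _

theorem agreeCount_add (Y Z : ℕ → Bool) (a n : ℕ) :
    agreeCount Y Z (a + n) =
      agreeCount Y Z a + agreeCount (fun i => Y (a + i)) (fun i => Z (a + i)) n :=
  Nat.count_add _ _ _

theorem agreeCount_le (Y Z : ℕ → Bool) (n : ℕ) : agreeCount Y Z n ≤ n := Nat.count_le _

theorem agreeCount_comm (Y Z : ℕ → Bool) (n : ℕ) : agreeCount Y Z n = agreeCount Z Y n := by
  simp [agreeCount, eq_comm]

theorem agreeCount_congr {Y Y' Z Z' : ℕ → Bool} {n : ℕ} (hY : ∀ i < n, Y i = Y' i)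
    (hZ : ∀ i < n, Z i = Z' i) : agreeCount Y Z n = agreeCount Y' Z' n := by
  induction n with
  | zero => rfl
  | succ n ih =>
    rw [agreeCount_succ, agreeCount_succ, ih (fun i hi => hY i (by omega))
      (fun i hi => hZ i (by omega)), hY n (by omega), hZ n (by omega)]

theorem agreeCount_not_add (Y Z : ℕ → Bool) (n : ℕ) :
    agreeCount Y (fun i => !Z i) n + agreeCount Y Z n = n := by
  induction n with
  | zero => rfl
  | succ n ih =>
    rw [agreeCount_succ, agreeCount_succ]
    have : (if Y n = !Z n then 1 else 0) + (if Y n = Z n then 1 else 0) = 1 := by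
      cases Y n <;> cases Z n <;> simp
    omega

theorem sum_sign_eq (u v : ℕ → Bool) (N : ℕ) :
    ∑ i ∈ Finset.range N, (if u i = v i then (1 : ℝ) else -1) = 2 * agreeCount u v N - N := by
  induction N with
  | zero => simp [agreeCount]
  | succ n ih =>
    rw [Finset.sum_range_succ, ih, agreeCount_succ]
    split_ifs <;> (push_cast; ring)

/-! ### List-decodable binary codes -/

/-- The words of length `N` given by the binary digits of `u` and `v` agree on at least the
fraction `1 / 2 + 1 / p` of the positions. -/
def Close (p N u v : ℕ) : Prop := (p + 2) * N ≤ 2 * p * agreeCount u.testBit v.testBit N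

instance (p N u v : ℕ) : Decidable (Close p N u v) := inferInstanceAs (Decidable (_ ≤ _))

theorem computable_close (p : ℕ) :
    Computable fun x : ℕ × ℕ × ℕ => decide (Close p x.1 x.2.1 x.2.2) := by
  have hu : Computable fun z : (ℕ × ℕ × ℕ) × ℕ => z.1.2.1.testBit z.2 :=
    computable_testBit.comp (Computable.fst.comp (Computable.snd.comp .fst)) .snd
  have hv : Computable fun z : (ℕ × ℕ × ℕ) × ℕ => z.1.2.2.testBit z.2 :=
    computable_testBit.comp (Computable.snd.comp (Computable.snd.comp .fst)) .snd
  have hp : Computable₂ fun (x : ℕ × ℕ × ℕ) i => x.2.1.testBit i == x.2.2.testBit i :=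
    (Primrec.beq (α := Bool)).to_comp.comp hu hv
  have hc : Computable fun x : ℕ × ℕ × ℕ => agreeCount x.2.1.testBit x.2.2.testBit x.1 := by
    refine (Computable.list_length.comp
      ((Computable.filterRange hp).comp .id .fst)).of_eq fun x => ?_
    obtain ⟨n, u, v⟩ := x
    change ((List.range n).filter fun i => u.testBit i == v.testBit i).length = _
    induction n with
    | zero => rfl
    | succ n ih =>
      rw [List.range_succ, List.filter_append, List.length_append, ih]
      simp only [agreeCount_succ]
      by_cases h : u.testBit n = v.testBit n <;> simp [h]
  exact Computable.decideLE (Primrec.nat_mul.to_comp.comp (.const _) .fst)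
    (Primrec.nat_mul.to_comp.comp (.const _) hc)

theorem Computable.decideClose {α : Type*} [Primcodable α] (p : ℕ) {f g h : α → ℕ}
    (hf : Computable f) (hg : Computable g) (hh : Computable h) :
    Computable fun a => decide (Close p (f a) (g a) (h a)) :=
  (computable_close p).comp (hf.pair (hg.pair hh))

/-- The generating function of the number of agreements with a fixed word. -/
theorem sum_pow_agreeCount (x : ℝ) (w : ℕ → Bool) (N : ℕ) :
    ∑ v ∈ Finset.range (2 ^ N), x ^ agreeCount v.testBit w N = (1 + x) ^ N := by
  induction N with
  | zero => simp [agreeCount]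
  | succ N ih =>
    have hcongr : ∀ v < 2 ^ N,
        agreeCount (2 ^ N + v).testBit w N = agreeCount v.testBit w N := fun v _ =>
      agreeCount_congr (fun i hi => Nat.testBit_two_pow_add_gt hi v) fun _ _ => rfl
    rw [pow_succ 2, mul_two, Finset.sum_range_add, pow_succ, ← ih, mul_add, mul_one,
      Finset.sum_mul, ← Finset.sum_add_distrib, ← Finset.sum_add_distrib]
    refine Finset.sum_congr rfl fun v hv => ?_
    have hv' := Finset.mem_range.1 hv
    rw [agreeCount_succ, agreeCount_succ, hcongr v hv', Nat.testBit_two_pow_add_eq,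
      Nat.testBit_lt_two_pow hv']
    cases w N <;> (simp [pow_succ]; try ring)

/-- A Chernoff bound: few words agree with a fixed word on the fraction `1 / 2 + 1 / p`. -/
theorem card_close_le {p : ℕ} (hp : 0 < p) (N w : ℕ) :
    (((Finset.range (2 ^ N)).filter fun v => Close p N v w).card : ℝ) ≤
      2 ^ N * Real.exp (-(2 * N / p ^ 2)) := by
  have hp' : (0 : ℝ) < p := by exact_mod_cast hp
  -- the optimal exponential weight per agreement
  set l : ℝ := 2 / p with hl
  set t : ℝ := (1 / 2 + 1 / p) * N with ht
  set S := (Finset.range (2 ^ N)).filter fun v => Close p N v w with hS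
  have h1 : (S.card : ℝ) * Real.exp (2 * l * t) ≤ (1 + Real.exp (2 * l)) ^ N := by
    rw [← sum_pow_agreeCount _ w.testBit N, ← nsmul_eq_mul]
    refine (Finset.card_nsmul_le_sum S _ _ fun v hv => ?_).trans
      (Finset.sum_le_sum_of_subset_of_nonneg (Finset.filter_subset _ _)
        fun _ _ _ => by positivity)
    rw [← Real.exp_nat_mul, Real.exp_le_exp]
    have hc : ((p : ℝ) + 2) * N ≤ 2 * p * agreeCount v.testBit w.testBit N := by
      exact_mod_cast (Finset.mem_filter.1 hv).2
    have : t ≤ agreeCount v.testBit w.testBit N := by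
      rw [ht, show (1 / 2 + 1 / (p : ℝ)) * N = ((p + 2) * N) / (2 * p) by field_simp,
        div_le_iff₀ (by positivity)]
      linarith
    have hl0 : 0 ≤ 2 * l := by positivity
    nlinarith [mul_le_mul_of_nonneg_left this hl0]
  have h2 : 1 + Real.exp (2 * l) ≤ 2 * Real.exp (l + l ^ 2 / 2) := by
    have := Real.cosh_le_exp_half_sq l
    rw [Real.cosh_eq] at this
    have e1 : Real.exp (2 * l) = Real.exp l * Real.exp l := by rw [← Real.exp_add]; ring_nf
    have e2 : Real.exp l * Real.exp (-l) = 1 := by rw [← Real.exp_add]; simp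
    rw [Real.exp_add, e1]
    nlinarith [Real.exp_pos l]
  have h3 : (S.card : ℝ) * Real.exp (2 * l * t) ≤ 2 ^ N * Real.exp (N * (l + l ^ 2 / 2)) := by
    rw [Real.exp_nat_mul, ← mul_pow]
    exact h1.trans (pow_le_pow_left₀ (by positivity) h2 N)
  have h4 : Real.exp (N * (l + l ^ 2 / 2)) =
      Real.exp (-(2 * N / p ^ 2)) * Real.exp (2 * l * t) := by
    rw [← Real.exp_add]
    congr 1
    rw [hl, ht]
    field_simp
    ring
  rw [h4, ← mul_assoc (2 ^ N : ℝ)] at h3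
  exact le_of_mul_le_mul_right h3 (Real.exp_pos _)

/-- The Gilbert–Varshamov greedy construction. -/
theorem exists_pairwise_not_close {p : ℕ} (hp : 0 < p) (N : ℕ) :
    ∃ l : List ℕ, l.length = 2 ^ (N / p ^ 2) ∧ l.Pairwise fun u v => ¬Close p N u v := by
  suffices ∀ j ≤ 2 ^ (N / p ^ 2), ∃ l : List ℕ, l.length = j ∧
      l.Pairwise fun u v => ¬Close p N u v from this _ le_rfl
  intro j
  induction j with
  | zero => exact fun _ => ⟨[], rfl, .nil⟩
  | succ j ih =>
    intro hj
    obtain ⟨l, hlen, hl⟩ := ih (by omega)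
    by_contra! hno
    -- by maximality, the balls around the words of `l` cover all words
    have hcov : Finset.range (2 ^ N) ⊆
        l.toFinset.biUnion fun w => (Finset.range (2 ^ N)).filter fun v => Close p N v w := by
      intro v hv
      by_contra hv'
      simp only [Finset.mem_biUnion, List.mem_toFinset, Finset.mem_filter, not_exists,
        not_and] at hv'
      exact hno (v :: l) (by simp [hlen])
        (List.pairwise_cons.2 ⟨fun w hw => hv' w hw hv, hl⟩)
    have hcard : ((2 ^ N : ℕ) : ℝ) ≤ j * (2 ^ N * Real.exp (-(2 * N / p ^ 2))) := by
      have h1 := (Finset.card_le_card hcov).trans Finset.card_biUnion_le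
      rw [Finset.card_range] at h1
      calc ((2 ^ N : ℕ) : ℝ) ≤ ∑ w ∈ l.toFinset,
            (((Finset.range (2 ^ N)).filter fun v => Close p N v w).card : ℝ) := by
              exact_mod_cast h1
        _ ≤ ∑ w ∈ l.toFinset, 2 ^ N * Real.exp (-(2 * N / p ^ 2)) :=
              Finset.sum_le_sum fun w _ => card_close_le hp N w
        _ ≤ _ := by
              rw [Finset.sum_const, nsmul_eq_mul]
              refine mul_le_mul_of_nonneg_right ?_ (by positivity)
              exact_mod_cast hlen ▸ l.toFinset_card_le
    have hj' : (j : ℝ) < 2 ^ (N / p ^ 2) := by exact_mod_cast hj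
    have hexp : (2 : ℝ) ^ (N / p ^ 2) ≤ Real.exp (2 * N / p ^ 2) := by
      have h2 : (2 : ℝ) ≤ Real.exp 1 := by linarith [Real.add_one_le_exp (1 : ℝ)]
      refine (pow_le_pow_left₀ (by norm_num) h2 _).trans ?_
      rw [← Real.exp_nat_mul, Real.exp_le_exp, mul_one]
      have := Nat.cast_div_le (α := ℝ) (m := N) (n := p ^ 2)
      push_cast at this
      have h0 : (0 : ℝ) ≤ N / p ^ 2 := by positivity
      rw [mul_div_assoc]
      linarith
    have hpos : (0 : ℝ) < 2 ^ N := by positivity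
    have hE := Real.exp_pos (-(2 * N / p ^ 2 : ℝ))
    have hone : Real.exp (2 * N / p ^ 2) * Real.exp (-(2 * N / p ^ 2)) = 1 := by
      rw [← Real.exp_add]; simp
    have : (j : ℝ) * Real.exp (-(2 * N / p ^ 2)) < 1 := by
      rw [← hone]
      exact mul_lt_mul_of_pos_right (hj'.trans_le hexp) hE
    push_cast at hcard
    nlinarith

/-- The Johnson bound: if the words `w m` pairwise agree on a fraction less than
`1 / 2 + 1 / p ^ 2`, then no word agrees with more than `p ^ 2` of them on the fraction
`1 / 2 + 1 / p`. -/
theorem card_le_of_close {p N : ℕ} (hp : 0 < p) (y : ℕ) (w : ℕ → ℕ) (D : Finset ℕ)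
    (hN : 0 < N) (hD : ∀ m ∈ D, Close p N y (w m))
    (hw : ∀ m ∈ D, ∀ m' ∈ D, m ≠ m' → ¬Close (p ^ 2) N (w m) (w m')) : D.card ≤ p ^ 2 := by
  have hp' : (0 : ℝ) < p := by exact_mod_cast hp
  have hN' : (0 : ℝ) < N := by exact_mod_cast hN
  let s : ℕ → ℕ → ℝ := fun m i => if (w m).testBit i = y.testBit i then 1 else -1
  have hss : ∀ m m' i, s m i * s m' i =
      if (w m).testBit i = (w m').testBit i then 1 else -1 := by
    intro m m' i
    simp only [s]
    cases (w m).testBit i <;> cases (w m').testBit i <;> cases y.testBit i <;> simp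
  have hlow : (D.card : ℝ) * (2 * N / p) ≤ ∑ i ∈ Finset.range N, ∑ m ∈ D, s m i := by
    rw [Finset.sum_comm, ← nsmul_eq_mul]
    refine Finset.card_nsmul_le_sum _ _ _ fun m hm => ?_
    rw [sum_sign_eq, agreeCount_comm, div_le_iff₀ hp']
    have : ((p : ℝ) + 2) * N ≤ 2 * p * agreeCount y.testBit (w m).testBit N := by
      exact_mod_cast hD m hm
    linarith
  have hup : ∑ i ∈ Finset.range N, (∑ m ∈ D, s m i) ^ 2 ≤
      D.card * N + D.card ^ 2 * (2 * N / p ^ 2) := by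
    have e : ∑ i ∈ Finset.range N, (∑ m ∈ D, s m i) ^ 2 =
        ∑ m ∈ D, ∑ m' ∈ D, ∑ i ∈ Finset.range N, s m i * s m' i := by
      simp_rw [pow_two, Finset.sum_mul_sum]
      rw [Finset.sum_comm]
      exact Finset.sum_congr rfl fun m _ => Finset.sum_comm
    rw [e]
    have hterm : ∀ m ∈ D, ∀ m' ∈ D, ∑ i ∈ Finset.range N, s m i * s m' i ≤
        (if m = m' then (N : ℝ) else 0) + 2 * N / p ^ 2 := by
      intro m hm m' hm'
      simp_rw [hss]
      rw [sum_sign_eq]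
      by_cases h : m = m'
      · have h0 : (agreeCount (w m).testBit (w m').testBit N : ℝ) ≤ N := by
          exact_mod_cast agreeCount_le _ _ _
        have : (0 : ℝ) ≤ 2 * N / p ^ 2 := by positivity
        simp only [h, if_true] at h0 ⊢
        linarith
      · have h0 := hw m hm m' hm' h
        rw [Close, not_le] at h0
        have h0' : 2 * (p : ℝ) ^ 2 * agreeCount (w m).testBit (w m').testBit N <
            (p ^ 2 + 2) * N := by exact_mod_cast h0
        simp only [h, if_false, zero_add]
        rw [le_div_iff₀ (by positivity)]
        linarith
    refine (Finset.sum_le_sum fun m hm => Finset.sum_le_sum fun m' hm' =>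
      hterm m hm m' hm').trans (le_of_eq ?_)
    simp only [Finset.sum_add_distrib, Finset.sum_ite_eq, Finset.sum_const, nsmul_eq_mul]
    rw [Finset.sum_congr rfl fun m hm => if_pos hm, Finset.sum_const, nsmul_eq_mul]
    ring
  have hcs := sq_sum_le_card_mul_sum_sq (s := Finset.range N) (f := fun i => ∑ m ∈ D, s m i)
  rw [Finset.card_range] at hcs
  have h0 : (0 : ℝ) ≤ D.card * (2 * N / p) := by positivity
  have h1 := (pow_le_pow_left₀ h0 hlow 2).trans (hcs.trans (mul_le_mul_of_nonneg_left hup hN'.le))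
  by_contra! hlt
  have hlt' : (p : ℝ) ^ 2 < D.card := by exact_mod_cast hlt
  set d : ℝ := (D.card : ℝ)
  have hd : 0 < d := lt_of_le_of_lt (by positivity) hlt'
  have e1 : (d * (2 * N / p)) ^ 2 = d * N ^ 2 / p ^ 2 * (4 * d) := by field_simp; norm_num
  have e2 : (N : ℝ) * (d * N + d ^ 2 * (2 * N / p ^ 2)) =
      d * N ^ 2 / p ^ 2 * (p ^ 2 + 2 * d) := by field_simp
  rw [e1, e2] at h1
  have := le_of_mul_le_mul_left h1 (by positivity)
  linarith

/-- For every `p` there is a computable family of binary codes of positive rate which are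
list-decodable, with lists of bounded size, from agreement on the fraction `1 / 2 + 1 / p`.
The code of length `N` has `2 ^ (N / q)` codewords `W N m`. -/
theorem exists_listDecodable {p : ℕ} (hp : 0 < p) :
    ∃ q L : ℕ, 0 < q ∧ 0 < L ∧ ∃ W : ℕ → ℕ → ℕ, Computable₂ W ∧ ∀ N y,
      ((List.range (2 ^ (N / q))).filter fun m => Close p N y (W N m)).length ≤ L := by
  have hp2 : 0 < p ^ 2 := by positivity
  have hmem : ∀ l : List ℕ, ∀ N, (∀ i < l.length, ∀ j < i,
      ¬Close (p ^ 2) N (l[i]?.getD 0) (l[j]?.getD 0)) ↔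
        ∀ i < l.length, decide (∀ j < i,
          (!decide (Close (p ^ 2) N (l[i]?.getD 0) (l[j]?.getD 0))) = true) = true := by
    simp
  have hP : Computable₂ fun (N : ℕ) (l : List ℕ) =>
      decide (l.length = 2 ^ (N / (p ^ 2) ^ 2)) && decide (∀ i < l.length, decide (∀ j < i,
        (!decide (Close (p ^ 2) N (l[i]?.getD 0) (l[j]?.getD 0))) = true) = true) := by
    have hget : ∀ {α : Type} [Primcodable α] {l : α → List ℕ} {i : α → ℕ}, Computable l →
        Computable i → Computable fun a => (l a)[i a]?.getD 0 := fun hl hi =>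
      Computable.option_getD (Computable.list_getElem?.comp hl hi) (.const 0)
    refine Primrec.and.to_comp.comp (Computable.decideEq (Computable.list_length.comp .snd)
      (computable_pow.comp (.const 2) (Primrec.nat_div.to_comp.comp .fst (.const _))))
      (Computable.forallLt ?_ (Computable.list_length.comp .snd))
    refine Computable.forallLt (p := fun (z : (ℕ × List ℕ) × ℕ) j =>
      !decide (Close (p ^ 2) z.1.1 (z.1.2[z.2]?.getD 0) (z.1.2[j]?.getD 0))) ?_ .snd
    refine Primrec.not.to_comp.comp (Computable.decideClose _ ?_ (hget ?_ ?_) (hget ?_ .snd))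
    · exact Computable.fst.comp (Computable.fst.comp .fst)
    · exact Computable.snd.comp (Computable.fst.comp .fst)
    · exact Computable.snd.comp .fst
    · exact Computable.snd.comp (Computable.fst.comp .fst)
  have hcomm : ∀ N u v, Close (p ^ 2) N u v ↔ Close (p ^ 2) N v u := fun N u v => by
    rw [Close, Close, agreeCount_comm]
  obtain ⟨C, hC, hCs⟩ := Computable.exists_search hP (fun N => by
    obtain ⟨l, hlen, hl⟩ := exists_pairwise_not_close hp2 N
    refine ⟨l, ?_⟩
    rw [Bool.and_eq_true, decide_eq_true_eq, decide_eq_true_eq, ← hmem]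
    refine ⟨hlen, fun i hi j hj => ?_⟩
    have hj' : j < l.length := hj.trans hi
    rw [hcomm]
    simpa [hi, hj'] using List.pairwise_iff_getElem.1 hl j i hj' hi hj)
  refine ⟨(p ^ 2) ^ 2, p ^ 2, by positivity, hp2, fun N m => (C N)[m]?.getD 0,
    Computable.option_getD (Computable.list_getElem?.comp (hC.comp .fst) .snd) (.const 0),
    fun N y => ?_⟩
  have hCN := hCs N
  rw [Bool.and_eq_true, decide_eq_true_eq, decide_eq_true_eq, ← hmem] at hCN
  rcases Nat.eq_zero_or_pos N with rfl | hN
  · refine (List.length_filter_le _ _).trans ?_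
    simpa using Nat.one_le_iff_ne_zero.2 hp2.ne'
  · rw [← List.toFinset_card_of_nodup (List.nodup_range.filter _)]
    refine card_le_of_close hp y (fun m => (C N)[m]?.getD 0) _ hN (fun m hm => ?_) ?_
    · simpa using (List.mem_filter.1 (List.mem_toFinset.1 hm)).2
    · intro m hm m' hm' hne
      have h1 := (List.mem_filter.1 (List.mem_toFinset.1 hm)).1
      have h2 := (List.mem_filter.1 (List.mem_toFinset.1 hm')).1
      rw [List.mem_range, ← hCN.1] at h1 h2
      rcases lt_or_gt_of_ne hne with h | h
      · rw [hcomm]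
        exact hCN.2 m' h2 m h
      · exact hCN.2 m h1 m' h

/-! ### Infinitely often equal functions -/

/-- Pigeonhole principle: if `P n` holds infinitely often and entails one of finitely many
properties `R i` at an index `φ n` that tends to infinity with `n`, then some `R i` holds
infinitely often. -/
theorem exists_frequently_of_frequently {P : ℕ → Prop} {R : ℕ → ℕ → Prop} {a : ℕ} {φ : ℕ → ℕ}
    (hP : ∃ᶠ n in atTop, P n) (hφ : Tendsto φ atTop atTop)
    (h : ∀ᶠ n in atTop, P n → ∃ i < a, R i (φ n)) : ∃ i < a, ∃ᶠ m in atTop, R i m := by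
  by_contra! hno
  have hall : ∀ᶠ m in atTop, ∀ i ∈ Finset.range a, ¬R i m :=
    (Finset.eventually_all _).2 fun i hi => hno i (Finset.mem_range.1 hi)
  refine hP ?_
  filter_upwards [h, hφ.eventually hall] with n h1 h2 hPn
  obtain ⟨i, hi, hR⟩ := h1 hPn
  exact h2 i (Finset.mem_range.2 hi) hR

/-- If finitely many functions together match every finite family of computable functions, then
one of them is infinitely often equal. -/
theorem exists_infinitelyOftenEqual {h : ℕ → ℕ} {a : ℕ} {F : ℕ → ℕ → ℕ}
    (hF : ∀ i m, F i m < h m)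
    (H : ∀ g : ℕ → ℕ → ℕ, (∀ i, Computable (g i)) → (∀ i < a, ∀ m, g i m < h m) →
      ∃ i < a, ∃ᶠ m in atTop, F i m = g i m) : ∃ i < a, InfinitelyOftenEqual h (F i) := by
  by_contra! hno
  have : ∀ i, ∃ g : ℕ → ℕ, Computable g ∧ (i < a → (∀ m, g m < h m) ∧
      ¬∃ᶠ m in atTop, F i m = g m) := by
    intro i
    by_cases hi : i < a
    · have := hno i hi
      rw [InfinitelyOftenEqual, not_and] at this
      have := this (hF i)
      push Not at this
      obtain ⟨g, hg, hgh, hgF⟩ := this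
      exact ⟨g, hg, fun _ => ⟨hgh, not_frequently.2 hgF⟩⟩
    · exact ⟨fun _ => 0, .const 0, fun h => absurd h hi⟩
  choose g hg hgF using this
  obtain ⟨i, hi, hfreq⟩ := H g hg fun i hi => (hgF i hi).1
  exact (hgF i hi).2 hfreq

/-- An infinitely often equal function for the bound `h` yields one for a slower growing bound
`h'`, by splitting the arguments into residue classes. -/
theorem exists_infinitelyOftenEqual_of_le {O : Set (ℕ →. ℕ)} {h h' f : ℕ → ℕ} {a : ℕ}
    (ha : 0 < a) (hh' : Computable h') (hpos : ∀ m, 0 < h' m)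
    (hle : ∀ m, ∀ r < a, h' m ≤ h (a * (m + 1) + r)) (hfO : ComputableIn O f)
    (hf : InfinitelyOftenEqual h f) :
    ∃ f' : ℕ → ℕ, ComputableIn O f' ∧ InfinitelyOftenEqual h' f' := by
  let F : ℕ → ℕ → ℕ := fun r m => f (a * (m + 1) + r) % h' m
  have hFO : ∀ r, ComputableIn O (F r) := fun r => by
    have hidx : Computable fun m => a * (m + 1) + r :=
      Primrec.nat_add.to_comp.comp
        (Primrec.nat_mul.to_comp.comp (.const a) .succ) (.const r)
    exact Primrec.nat_mod.to_comp.compIn (hfO.comp hidx.computableIn) hh'.computableIn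
  suffices ∃ i < a, InfinitelyOftenEqual h' (F i) from
    let ⟨i, _, hi⟩ := this
    ⟨F i, hFO i, hi⟩
  refine exists_infinitelyOftenEqual (fun i m => Nat.mod_lt _ (hpos m)) fun g hg hgh => ?_
  obtain ⟨G, hG, hGg⟩ := exists_computable₂_of_forall hg a
  let g' : ℕ → ℕ := fun n => bif decide (a ≤ n) then G (n % a) (n / a - 1) else 0
  have hg' : Computable g' :=
    Computable.cond (Computable.decideLE (.const a) .id)
      (hG.comp (Primrec.nat_mod.to_comp.comp .id (.const a))
        (Computable.pred.comp (Primrec.nat_div.to_comp.comp .id (.const a)))) (.const 0)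
  have hdec : ∀ n, a ≤ n → a * (n / a - 1 + 1) + n % a = n := fun n hn => by
    rw [Nat.sub_add_cancel (Nat.div_pos hn ha), Nat.div_add_mod]
  have hval : ∀ n, a ≤ n → g' n = g (n % a) (n / a - 1) := fun n hn => by
    simp [g', hn, hGg _ (Nat.mod_lt n ha)]
  have hbd : ∀ n, g' n < h n := by
    intro n
    by_cases hn : a ≤ n
    · rw [hval n hn]
      have h1 := hgh _ (Nat.mod_lt n ha) (n / a - 1)
      have h2 := hle (n / a - 1) _ (Nat.mod_lt n ha)
      rw [hdec n hn] at h2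
      omega
    · have := hf.1 n
      simp only [g', hn, decide_false, cond_false]
      omega
  have hφ : Tendsto (fun n => n / a - 1) atTop atTop :=
    (tendsto_sub_atTop_nat 1).comp (Nat.tendsto_div_const_atTop ha.ne')
  refine exists_frequently_of_frequently (hf.2 g' hg' hbd) hφ ?_
  filter_upwards [eventually_ge_atTop a] with n hn hfn
  refine ⟨n % a, Nat.mod_lt n ha, ?_⟩
  simp only [F]
  rw [hdec n hn, hfn, hval n hn, Nat.mod_eq_of_lt (hgh _ (Nat.mod_lt n ha) _)]

/-- A finite family of computable functions below `B` is coded digit by digit, in base `B`, in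
a single computable function. -/
theorem exists_computable_digits {B : ℕ → ℕ} (hB : Computable B) {g : ℕ → ℕ → ℕ}
    (hg : ∀ i, Computable (g i)) (L : ℕ) (hgB : ∀ i < L, ∀ k, g i k < B k) :
    ∃ c : ℕ → ℕ, Computable c ∧ (∀ k, c k < B k ^ L) ∧
      ∀ i < L, ∀ k, c k / B k ^ i % B k = g i k := by
  induction L with
  | zero => exact ⟨fun _ => 0, .const 0, by simp, by simp⟩
  | succ L ih =>
    obtain ⟨c, hc, hcB, hcg⟩ := ih fun i hi => hgB i (by omega)
    refine ⟨fun k => c k + B k ^ L * g L k, Primrec.nat_add.to_comp.comp hc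
      (Primrec.nat_mul.to_comp.comp (computable_pow.comp hB (.const L)) (hg L)),
      fun k => ?_, fun i hi k => ?_⟩
    · dsimp only
      have h1 := hcB k
      have h2 : B k ^ L * (g L k + 1) ≤ B k ^ L * B k :=
        Nat.mul_le_mul_left _ (hgB L (by omega) k)
      rw [pow_succ]
      rw [mul_add, mul_one] at h2
      omega
    · dsimp only
      have hBk : 0 < B k := (Nat.zero_le _).trans_lt (hgB L (by omega) k)
      rcases Nat.lt_succ_iff_lt_or_eq.1 hi with h | rfl
      · obtain ⟨j, rfl⟩ := Nat.exists_eq_add_of_lt h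
        rw [show i + j + 1 = i + (j + 1) by ring, pow_add, mul_assoc,
          Nat.add_mul_div_left _ _ (by positivity), pow_succ, mul_comm (B k ^ j), mul_assoc,
          Nat.add_mul_mod_self_left]
        exact hcg i h k
      · rw [Nat.add_mul_div_left _ _ (by positivity), Nat.div_eq_of_lt (hcB k), zero_add,
          Nat.mod_eq_of_lt (hgB i hi k)]

/-- From a trace by lists of bounded length `L` that catches every computable function below
`h` infinitely often, one obtains an infinitely often equal function, for the bound `B` with
`B ^ L ≤ h`: the values traced are read as `L`-tuples, and for some `i` the `i`-th entry of the
`i`-th member of the list works. -/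
theorem exists_infinitelyOftenEqual_of_trace {O : Set (ℕ →. ℕ)} {B h : ℕ → ℕ} {L : ℕ}
    {T : ℕ → List ℕ} (hB : Computable B) (hBpos : ∀ k, 0 < B k) (hBh : ∀ k, B k ^ L ≤ h k)
    (hTO : ComputableIn O T) (hTL : ∀ k, (T k).length ≤ L)
    (hT : ∀ g : ℕ → ℕ, Computable g → (∀ k, g k < h k) → ∃ᶠ k in atTop, g k ∈ T k) :
    ∃ f : ℕ → ℕ, ComputableIn O f ∧ InfinitelyOftenEqual B f := by
  let F : ℕ → ℕ → ℕ := fun i k => (T k)[i]?.getD 0 / B k ^ i % B k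
  have hFO : ∀ i, ComputableIn O (F i) := fun i => by
    have hget : Computable fun l : List ℕ => l[i]?.getD 0 :=
      Computable.option_getD (Computable.list_getElem?.comp .id (.const i)) (.const 0)
    exact Primrec.nat_mod.to_comp.compIn (Primrec.nat_div.to_comp.compIn (hget.compIn hTO)
      (computable_pow.comp hB (.const i)).computableIn) hB.computableIn
  suffices ∃ i < L, InfinitelyOftenEqual B (F i) from
    let ⟨i, _, hi⟩ := this
    ⟨F i, hFO i, hi⟩
  refine exists_infinitelyOftenEqual (fun i m => Nat.mod_lt _ (hBpos m)) fun g hg hgB => ?_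
  obtain ⟨c, hc, hcB, hcg⟩ := exists_computable_digits hB hg L hgB
  refine exists_frequently_of_frequently
    (hT c hc fun k => (hcB k).trans_le (hBh k)) tendsto_id ?_
  refine Eventually.of_forall fun k hk => ?_
  obtain ⟨i, hi, hik⟩ := List.getElem_of_mem hk
  have hiL := hi.trans_le (hTL k)
  refine ⟨i, hiL, ?_⟩
  simp [F, hi, hik, hcg i hiL k]

/-! ### Computable traces of bounded size -/

/-- If lists of bounded length, computable from `k`, contain an initial segment of `X` of length
at least `k` for all large `k`, then `X` is computable. If the members of the lists come to
agree on every digit, then `X` can be read off; otherwise they permanently disagree on some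
digit, and fixing this digit shortens the lists. -/
theorem computable_of_trace (L : ℕ) {X : ℕ → Bool} {T : ℕ → List ℕ} (hT : Computable T)
    (hTL : ∀ᶠ k in atTop, (T k).length ≤ L)
    (hX : ∀ᶠ k in atTop, ∃ u ∈ T k, ∀ i < k, u.testBit i = X i) : Computable X := by
  induction L generalizing T with
  | zero =>
    obtain ⟨k, h1, u, h2, -⟩ := (hTL.and hX).exists
    simp [List.length_eq_zero_iff.1 (Nat.le_zero.1 h1)] at h2
  | succ L ih =>
    obtain ⟨k₀, hk₀⟩ := eventually_atTop.1 hX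
    have hsel : ∀ {α : Type} [Primcodable α] {l : α → List ℕ} {n : α → ℕ} {b : α → Bool},
        Computable l → Computable n → Computable b →
        Computable fun a => (l a).filter fun u => u.testBit (n a) == b a := by
      intro α _ l n b hl hn hb
      have hrel : PrimrecRel fun (u : ℕ) (x : ℕ × Bool) => u.testBit x.1 = x.2 := by
        have : Primrec fun z : ℕ × ℕ × Bool => decide (z.1 / 2 ^ z.2.1 % 2 = 1) :=
          (Primrec.eq (α := ℕ)).decide.comp (Primrec.nat_mod.comp (Primrec.nat_div.comp .fst
            ((Primrec₂.unpaired'.1 Nat.Primrec.pow).comp (.const 2)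
              (Primrec.fst.comp .snd))) (.const 2)) (.const 1)
        refine (Primrec.eq (α := Bool)).comp (this.of_eq fun z => ?_) (Primrec.snd.comp .snd)
        rw [Nat.testBit_eq_decide_div_mod_eq]
      refine (hrel.listFilter.to_comp.comp hl (hn.pair hb)).of_eq fun a => ?_
      congr 1
    by_cases hcase : ∀ n, ∃ k b, k₀ + n < k ∧ ((T k).filter fun u => u.testBit n == !b) = []
    · have hp : Computable₂ fun (n : ℕ) (x : ℕ × Bool) => decide (k₀ + n + 1 ≤ x.1) &&
          decide (((T x.1).filter fun u => u.testBit n == !x.2).length = 0) := by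
        refine Primrec.and.to_comp.comp (Computable.decideLE (Computable.succ.comp
          (Primrec.nat_add.to_comp.comp (.const k₀) .fst)) (Computable.fst.comp .snd))
          (Computable.decideEq (Computable.list_length.comp (hsel
            (hT.comp (Computable.fst.comp .snd)) .fst
            (Primrec.not.to_comp.comp (Computable.snd.comp .snd)))) (.const 0))
      obtain ⟨S, hS, hSs⟩ := Computable.exists_search hp fun n => by
        obtain ⟨k, b, h1, h2⟩ := hcase n
        exact ⟨(k, b), by simp [h2, Nat.succ_le_of_lt h1]⟩
      refine (Computable.snd.comp hS).of_eq fun n => ?_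
      have := hSs n
      rw [Bool.and_eq_true, decide_eq_true_eq, decide_eq_true_eq, List.length_eq_zero_iff,
        List.filter_eq_nil_iff] at this
      obtain ⟨u, hu, huX⟩ := hk₀ (S n).1 (by omega)
      have h1 := this.2 u hu
      rw [huX n (by omega)] at h1
      cases hb : (S n).2 <;> cases hXn : X n <;> simp_all
    · push Not at hcase
      obtain ⟨n, hn⟩ := hcase
      refine ih (T := fun k => (T k).filter fun u => u.testBit n == X n)
        (hsel hT (.const n) (.const (X n))) ?_ ?_
      · filter_upwards [hTL, eventually_gt_atTop (k₀ + n)] with k h1 h2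
        obtain ⟨u, hu⟩ := List.exists_mem_of_ne_nil _ (hn k (X n) h2)
        rw [List.mem_filter] at hu
        have hlt : ((T k).filter fun u => u.testBit n == X n).length < (T k).length :=
          List.length_filter_lt_length_iff_exists.2 ⟨u, hu.1, by
            have := hu.2
            cases hXn : X n <;> simp_all⟩
        omega
      · filter_upwards [hX, eventually_gt_atTop n] with k h1 h2
        obtain ⟨u, hu, huX⟩ := h1
        exact ⟨u, List.mem_filter.2 ⟨hu, by simp [huX n h2]⟩, huX⟩

/-! ### Lower density -/

theorem ncard_agreement_inter_Iio (Y Z : ℕ → Bool) (n : ℕ) :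
    (agreement Y Z ∩ Set.Iio n).ncard = agreeCount Y Z n := by
  rw [agreeCount, Nat.count_eq_card_filter_range, ← Set.ncard_coe_finset]
  congr 1
  ext i
  simp [agreement, and_comm]

theorem lowerDensity_agreement (Y Z : ℕ → Bool) : lowerDensity (agreement Y Z) =
    liminf (fun n : ℕ => (agreeCount Y Z n : ℝ) / n) atTop := by
  simp only [lowerDensity, ncard_agreement_inter_Iio]

theorem agreeCount_div_nonneg (Y Z : ℕ → Bool) (n : ℕ) : 0 ≤ (agreeCount Y Z n : ℝ) / n := by
  positivity

theorem agreeCount_div_le_one (Y Z : ℕ → Bool) (n : ℕ) : (agreeCount Y Z n : ℝ) / n ≤ 1 :=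
  div_le_one_of_le₀ (by exact_mod_cast agreeCount_le Y Z n) (by positivity)

theorem isBoundedUnder_ge_agreeCount_div (Y Z : ℕ → Bool) :
    IsBoundedUnder (· ≥ ·) atTop fun n : ℕ => (agreeCount Y Z n : ℝ) / n :=
  isBoundedUnder_of ⟨0, agreeCount_div_nonneg Y Z⟩

theorem isCoboundedUnder_ge_agreeCount_div (Y Z : ℕ → Bool) :
    IsCoboundedUnder (· ≥ ·) atTop fun n : ℕ => (agreeCount Y Z n : ℝ) / n :=
  (isBoundedUnder_of ⟨1, agreeCount_div_le_one Y Z⟩ :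
    IsBoundedUnder (· ≤ ·) atTop _).isCoboundedUnder_ge

theorem lowerDensity_agreement_nonneg (Y Z : ℕ → Bool) : 0 ≤ lowerDensity (agreement Y Z) := by
  rw [lowerDensity_agreement]
  exact le_liminf_of_le (isCoboundedUnder_ge_agreeCount_div Y Z)
    (Eventually.of_forall (agreeCount_div_nonneg Y Z))

theorem lowerDensity_agreement_le {Y Z : ℕ → Bool} {c : ℝ}
    (h : ∃ᶠ n in atTop, (agreeCount Y Z n : ℝ) ≤ c * n) : lowerDensity (agreement Y Z) ≤ c := by
  rw [lowerDensity_agreement]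
  refine liminf_le_of_frequently_le ?_ (isBoundedUnder_ge_agreeCount_div Y Z)
  refine (h.and_eventually (eventually_gt_atTop 0)).mono fun n hn => ?_
  rw [div_le_iff₀ (by exact_mod_cast hn.2)]
  exact hn.1

theorem lowerDensity_agreement_le_one (Y Z : ℕ → Bool) : lowerDensity (agreement Y Z) ≤ 1 :=
  lowerDensity_agreement_le (Frequently.of_forall fun n => by
    rw [one_mul]; exact_mod_cast agreeCount_le Y Z n)

theorem frequently_of_lowerDensity_lt {Y Z : ℕ → Bool} {c : ℝ}
    (h : lowerDensity (agreement Y Z) < c) : ∃ᶠ n in atTop, (agreeCount Y Z n : ℝ) < c * n := by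
  rw [lowerDensity_agreement] at h
  have := frequently_lt_of_liminf_lt (isCoboundedUnder_ge_agreeCount_div Y Z) h
  refine (this.and_eventually (eventually_gt_atTop 0)).mono fun n hn => ?_
  rw [← div_lt_iff₀ (by exact_mod_cast hn.2)]
  exact hn.1

theorem eventually_of_lt_lowerDensity {Y Z : ℕ → Bool} {c : ℝ}
    (h : c < lowerDensity (agreement Y Z)) : ∀ᶠ n in atTop, c * n < (agreeCount Y Z n : ℝ) := by
  rw [lowerDensity_agreement] at h
  have := eventually_lt_of_lt_liminf h (isBoundedUnder_ge_agreeCount_div Y Z)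
  filter_upwards [this, eventually_gt_atTop 0] with n hn h0
  rwa [← lt_div_iff₀ (by exact_mod_cast h0)]

theorem lowerDensity_agreement_self (Y : ℕ → Bool) : lowerDensity (agreement Y Y) = 1 := by
  have h : ∀ n, agreeCount Y Y n = n := fun n => by simp [agreeCount]
  refine le_antisymm (lowerDensity_agreement_le_one Y Y) (le_of_forall_lt fun c hc => ?_)
  obtain ⟨d, hcd, hd⟩ := exists_between hc
  refine hcd.trans_le ?_
  rw [lowerDensity_agreement]
  refine le_liminf_of_le (isCoboundedUnder_ge_agreeCount_div Y Y) ?_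
  filter_upwards [eventually_gt_atTop 0] with n hn
  have : (n : ℝ) ≠ 0 := by exact_mod_cast hn.ne'
  rw [h, div_self this]
  exact hd.le

/-! ### The values `γ` and `Γ` -/

theorem lowerDensity_le_gammaValue (Y : ℕ → Bool) {Z : ℕ → Bool} (hZ : Computable Z) :
    lowerDensity (agreement Y Z) ≤ gammaValue Y :=
  le_csSup ⟨1, by rintro r ⟨W, -, rfl⟩; exact lowerDensity_agreement_le_one Y W⟩ ⟨Z, hZ, rfl⟩

theorem gammaValue_nonneg (Y : ℕ → Bool) : 0 ≤ gammaValue Y :=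
  (lowerDensity_agreement_nonneg Y _).trans
    (lowerDensity_le_gammaValue Y (Computable.const false))

theorem gammaValue_le {Y : ℕ → Bool} {c : ℝ}
    (h : ∀ Z : ℕ → Bool, Computable Z → lowerDensity (agreement Y Z) ≤ c) : gammaValue Y ≤ c :=
  csSup_le ⟨_, _, Computable.const false, rfl⟩ (by rintro r ⟨Z, hZ, rfl⟩; exact h Z hZ)

theorem gammaValue_eq_one {Y : ℕ → Bool} (hY : Computable Y) : gammaValue Y = 1 :=
  le_antisymm (gammaValue_le fun Z _ => lowerDensity_agreement_le_one Y Z)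
    ((lowerDensity_agreement_self Y).symm.le.trans (lowerDensity_le_gammaValue Y hY))

theorem nonempty_gammaValues (X : ℕ → Bool) :
    {r : ℝ | ∃ Y : ℕ → Bool, Computes X Y ∧ r = gammaValue Y}.Nonempty :=
  ⟨_, _, (Computable.const false).computableIn, rfl⟩

theorem GammaValue_nonneg (X : ℕ → Bool) : 0 ≤ GammaValue X :=
  le_csInf (nonempty_gammaValues X) (by rintro r ⟨Y, -, rfl⟩; exact gammaValue_nonneg Y)

theorem GammaValue_le {X Y : ℕ → Bool} (hY : Computes X Y) : GammaValue X ≤ gammaValue Y :=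
  csInf_le ⟨0, by rintro r ⟨Y, -, rfl⟩; exact gammaValue_nonneg Y⟩ ⟨Y, hY, rfl⟩

theorem computes_self (X : ℕ → Bool) : Computes X X := by
  have h : ComputableIn {seqOracle X} fun n => (X n).toNat := RecursiveIn.oracle _ rfl
  have hX : Computable fun n : ℕ => decide (n = 1) := Computable.decideEq .id (.const 1)
  have := hX.compIn h
  have e : (fun n => decide ((X n).toNat = 1)) = X := by
    ext n
    cases X n <;> rfl
  rwa [e] at this

theorem Computes.computable {X Y : ℕ → Bool} (h : Computes X Y) (hX : Computable X) :
    Computable Y := by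
  refine RecursiveIn.partrec_of_oracle ?_ h
  rintro g rfl
  exact ((Primrec.dom_bool Bool.toNat).to_comp.comp hX).partrec

theorem GammaValue_eq_one {X : ℕ → Bool} (hX : Computable X) : GammaValue X = 1 :=
  le_antisymm ((GammaValue_le (computes_self X)).trans (gammaValue_eq_one hX).le)
    (le_csInf (nonempty_gammaValues X) (by
      rintro r ⟨Y, hY, rfl⟩; exact (gammaValue_eq_one (hY.computable hX)).ge))

/-! ### Geometric blocks and infinitely often equal functions -/

theorem strictMono_pow_sub_one {K : ℕ} (hK : 1 < K) : StrictMono fun k => K ^ k - 1 := by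
  refine strictMono_nat_of_lt_succ fun k => ?_
  have h1 : 0 < K ^ k := by positivity
  have h2 : K ^ k < K ^ (k + 1) := Nat.pow_lt_pow_succ hK
  omega

theorem computable_pow_sub_one (K : ℕ) : Computable fun k => K ^ k - 1 :=
  Computable.pred.comp (computable_pow.comp (.const K) .id)

theorem mul_pow_sub_one_le (K k : ℕ) : K * (K ^ k - 1) ≤ K ^ (k + 1) - 1 := by
  rcases Nat.eq_zero_or_pos K with rfl | hK
  · simp
  · rw [Nat.mul_sub, pow_succ']
    omega

/-- On blocks whose right ends grow by factors of at least `K`, a sequence that disagrees with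
each computable sequence throughout infinitely many blocks has `γ`-value at most `1 / K`. -/
theorem GammaValue_le_of_infinitelyOftenEqual {X : ℕ → Bool} {f : ℕ → ℕ} {K : ℕ} (hK : 1 < K)
    (hfX : Computes X f) (hf : InfinitelyOftenEqual (fun n => 2 ^ (2 ^ n)) f) :
    GammaValue X ≤ 1 / K := by
  set b : ℕ → ℕ := fun k => K ^ k - 1 with hb
  have hbc : Computable b := computable_pow_sub_one K
  have hbm : StrictMono b := strictMono_pow_sub_one hK
  have hb0 : b 0 = 0 := by simp [hb]
  obtain ⟨f', hf'X, hf'⟩ := exists_infinitelyOftenEqual_of_le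
    (h' := fun m => 2 ^ (b (m + 1) - b m)) (a := K) (by omega)
    (computable_pow.comp (.const 2) (computable_blockLength hbc)) (fun m => by positivity)
    (fun m r _ => by
      refine Nat.pow_le_pow_right (by norm_num) ?_
      calc b (m + 1) - b m ≤ K ^ (m + 1) := by simp only [hb]; omega
        _ ≤ (2 ^ K) ^ (m + 1) := Nat.pow_le_pow_left Nat.lt_two_pow_self.le _
        _ = 2 ^ (K * (m + 1)) := by rw [pow_mul]
        _ ≤ _ := Nat.pow_le_pow_right (by norm_num) (by omega)) hfX hf
  obtain ⟨Y, hYX, hY⟩ := exists_concat hbc hbm hb0 hf'X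
  have hnX : Computes X fun n => !Y n := Primrec.not.to_comp.compIn hYX
  refine (GammaValue_le hnX).trans (gammaValue_le fun Z hZ => lowerDensity_agreement_le ?_)
  have hfreq := hf'.2 (blockCode b Z)
    (computableIn_empty_iff.1 (computableIn_blockCode hbc (computableIn_empty_iff.2 hZ)))
    (blockCode_lt hbm Z)
  refine (hbm.tendsto_atTop.comp (tendsto_add_atTop_nat 1)).frequently (hfreq.mono fun m hm => ?_)
  have hdis : ∀ i, i < b (m + 1) - b m → Y (b m + i) = Z (b m + i) := fun i hi => by
    rw [hY m i hi, hm, testBit_blockCode Z hi]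
  have hlen : b m + (b (m + 1) - b m) = b (m + 1) :=
    Nat.add_sub_cancel' (hbm (Nat.lt_succ_self m)).le
  have hcount : agreeCount (fun n => !Y n) Z (b (m + 1)) ≤ b m := by
    rw [← hlen, agreeCount_add]
    have h0 : agreeCount (fun i => !Y (b m + i)) (fun i => Z (b m + i)) (b (m + 1) - b m) = 0 := by
      rw [agreeCount_congr (Y' := fun i => !Z (b m + i)) (fun i hi => by rw [hdis i hi])
        fun _ _ => rfl]
      simp [agreeCount]
    rw [h0]
    exact agreeCount_le _ _ _
  have hK' : (0 : ℝ) < K := by exact_mod_cast (by omega : 0 < K)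
  have h1 : (K : ℝ) * b m ≤ b (m + 1) := by exact_mod_cast mul_pow_sub_one_le K m
  have h2 : (agreeCount (fun n => !Y n) Z (b (m + 1)) : ℝ) ≤ b m := by exact_mod_cast hcount
  simp only [Function.comp]
  rw [div_mul_eq_mul_div, one_mul, le_div_iff₀ hK']
  nlinarith

theorem GammaValue_eq_zero {X : ℕ → Bool} {f : ℕ → ℕ} (hfX : Computes X f)
    (hf : InfinitelyOftenEqual (fun n => 2 ^ (2 ^ n)) f) : GammaValue X = 0 := by
  refine le_antisymm (le_of_forall_pos_le_add fun ε hε => ?_) (GammaValue_nonneg X)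
  obtain ⟨n, hn⟩ := exists_nat_one_div_lt hε
  refine (GammaValue_le_of_infinitelyOftenEqual (K := n + 2) (by omega) hfX hf).trans ?_
  have : (1 : ℝ) / (n + 2 : ℕ) ≤ 1 / (n + 1) :=
    one_div_le_one_div_of_le (by positivity) (by push_cast; linarith)
  linarith

/-! ### Transfer through a list-decodable code -/

/-- The messages whose codewords agree with the word `y` of length `N` on the fraction
`1 / 2 + 1 / p`, for the code with `2 ^ (N / q)` codewords `W N m`. -/
def decodeList (p q : ℕ) (W : ℕ → ℕ → ℕ) (N y : ℕ) : List ℕ :=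
  (List.range (2 ^ (N / q))).filter fun m => Close p N y (W N m)

theorem mem_decodeList {p q : ℕ} {W : ℕ → ℕ → ℕ} {N y m : ℕ} :
    m ∈ decodeList p q W N y ↔ m < 2 ^ (N / q) ∧ Close p N y (W N m) := by
  simp [decodeList]

theorem computable_decodeList (p q : ℕ) {W : ℕ → ℕ → ℕ} (hW : Computable₂ W) :
    Computable₂ (decodeList p q W) := by
  have h : Computable₂ fun (x : ℕ × ℕ) m => decide (Close p x.1 x.2 (W x.1 m)) :=
    Computable.decideClose p (Computable.fst.comp .fst) (Computable.snd.comp .fst)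
      (hW.comp (Computable.fst.comp .fst) .snd)
  exact (Computable.filterRange h).comp .id
    (computable_pow.comp (.const 2) (Primrec.nat_div.to_comp.comp .fst (.const q)))

theorem computableIn_decodeList {O : Set (ℕ →. ℕ)} (p q : ℕ) {W : ℕ → ℕ → ℕ}
    (hW : Computable₂ W) {b : ℕ → ℕ} (hb : Computable b) {Y : ℕ → Bool} (hY : ComputableIn O Y) :
    ComputableIn O fun k => decodeList p q W (b (k + 1) - b k) (blockCode b Y k) :=
  (computable_decodeList p q hW).compIn (computable_blockLength hb).computableIn
    (computableIn_blockCode hb hY)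

/-- The number of agreements of two sequences in the `k`-th block `[b k, b (k + 1))`. -/
def blockAgree (b : ℕ → ℕ) (Y Z : ℕ → Bool) (k : ℕ) : ℕ :=
  agreeCount (fun i => Y (b k + i)) (fun i => Z (b k + i)) (b (k + 1) - b k)

theorem agreeCount_block_succ {b : ℕ → ℕ} (hb : StrictMono b) (Y Z : ℕ → Bool) (k : ℕ) :
    agreeCount Y Z (b (k + 1)) = agreeCount Y Z (b k) + blockAgree b Y Z k := by
  rw [blockAgree, ← agreeCount_add, Nat.add_sub_cancel' (hb (Nat.lt_succ_self k)).le]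

theorem close_blockCode_iff {b : ℕ → ℕ} {p k w : ℕ} {Y Z : ℕ → Bool}
    (hZ : ∀ i, i < b (k + 1) - b k → Z (b k + i) = w.testBit i) :
    Close p (b (k + 1) - b k) (blockCode b Y k) w ↔
      (p + 2) * (b (k + 1) - b k) ≤ 2 * p * blockAgree b Y Z k := by
  rw [Close, blockAgree, agreeCount_congr (fun i hi => testBit_blockCode Y hi)
    fun i hi => (hZ i hi).symm]

/-! ### Noncomputable sequences have `Γ` at most `1 / 2` -/

/-- If `X` is not computable, the concatenation of the codewords of the initial segments of `X`
has small `γ`-value: a computable sequence agreeing with it on a larger fraction of all long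
initial segments would agree with almost every codeword on more than half of its digits, and list
decoding would yield a computable trace of bounded size for `X`. -/
theorem GammaValue_le_of_not_computable {X : ℕ → Bool} (hX : ¬Computable X) {p : ℕ}
    (hp : 0 < p) : GammaValue X ≤ 1 / 2 + 2 / p := by
  obtain ⟨q, L, hq, -, W, hW, hWL⟩ := exists_listDecodable hp
  -- `p < K` makes the positions before a block negligible, and `q < K` makes the code of each
  -- block large enough for the initial segment of length `k`
  set K := p + q + 1 with hK
  set b : ℕ → ℕ := fun k => K ^ k - 1 with hb
  have hbc : Computable b := computable_pow_sub_one K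
  have hbm : StrictMono b := strictMono_pow_sub_one (by omega)
  have hb0 : b 0 = 0 := by simp [hb]
  obtain ⟨Y, hYX, hY⟩ := exists_concat hbc hbm hb0
    (hW.compIn (computable_blockLength hbc).computableIn
      (computableIn_prefixCode (computes_self X)))
  refine (GammaValue_le hYX).trans (gammaValue_le fun Z hZ => ?_)
  by_contra! hlt
  refine hX (computable_of_trace L
    (T := fun k => decodeList p q W (b (k + 1) - b k) (blockCode b Z k))
    (computableIn_empty_iff.1 (computableIn_decodeList p q hW hbc (computableIn_empty_iff.2 hZ)))
    (Eventually.of_forall fun k => hWL _ _) ?_)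
  have htend : Tendsto (fun k => b (k + 1)) atTop atTop :=
    hbm.tendsto_atTop.comp (tendsto_add_atTop_nat 1)
  filter_upwards [htend.eventually (eventually_of_lt_lowerDensity hlt)] with k hk
  refine ⟨prefixCode X k, mem_decodeList.2 ⟨?_, ?_⟩, fun i hi => testBit_prefixCode X hi⟩
  · refine (prefixCode_lt X k).trans_le (Nat.pow_le_pow_right (by norm_num) ?_)
    rw [Nat.le_div_iff_mul_le hq]
    have h1 : k < K ^ k := Nat.lt_pow_self (by omega)
    have h2 : b (k + 1) - b k = K ^ k * (K - 1) := by
      simp only [hb]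
      rw [Nat.mul_sub, pow_succ, mul_one]
      omega
    rw [h2]
    exact Nat.mul_le_mul h1.le (by omega)
  · rw [close_blockCode_iff (hY k)]
    have h1 := agreeCount_block_succ hbm Y Z k
    have h2 := agreeCount_le Y Z (b k)
    have h3 : p * b k ≤ b (k + 1) :=
      (Nat.mul_le_mul_right _ (by omega)).trans (mul_pow_sub_one_le K k)
    have hp' : (0 : ℝ) < p := by exact_mod_cast hp
    have h4 : blockAgree b Z Y k = blockAgree b Y Z k := agreeCount_comm _ _ _
    rw [h4]
    rw [h1] at hk
    have h5 : ((p : ℝ) + 4) * b (k + 1) < 2 * p * (b k + blockAgree b Y Z k) := by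
      have h2' : (agreeCount Y Z (b k) : ℝ) ≤ b k := by exact_mod_cast h2
      push_cast at hk
      have := mul_lt_mul_of_pos_left hk (by positivity : (0 : ℝ) < 2 * p)
      have e : 2 * (p : ℝ) * ((1 / 2 + 2 / p) * b (k + 1)) = (p + 4) * b (k + 1) := by
        field_simp
        ring
      rw [e] at this
      nlinarith
    have h5' : (p + 4) * b (k + 1) < 2 * p * (b k + blockAgree b Y Z k) := by exact_mod_cast h5
    have h6 : (p + 2) * (b (k + 1) - b k) ≤ (p + 2) * b (k + 1) :=
      Nat.mul_le_mul_left _ (Nat.sub_le _ _)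
    nlinarith

/-! ### `Γ` below `1 / 2` -/

/-- Block boundaries with `b (k + 1) = b k + ⌊b k / p⌋ + 1`: the length of each block is about
the fraction `1 / p` of what comes before it. -/
def slowBlocks (p k : ℕ) : ℕ := Nat.rec 0 (fun _ c => c + c / p + 1) k

theorem slowBlocks_succ (p k : ℕ) :
    slowBlocks p (k + 1) = slowBlocks p k + slowBlocks p k / p + 1 := rfl

theorem computable_slowBlocks (p : ℕ) : Computable (slowBlocks p) := by
  refine (Primrec.nat_rec₁ (f := fun _ c => c + c / p + 1) 0 ?_).to_comp
  exact Primrec.succ.comp (Primrec.nat_add.comp .snd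
    (Primrec.nat_div.comp .snd (.const p)))

theorem strictMono_slowBlocks (p : ℕ) : StrictMono (slowBlocks p) :=
  strictMono_nat_of_lt_succ fun k => by
    rw [slowBlocks_succ]
    exact Nat.lt_succ_of_le (Nat.le_add_right _ _)

theorem slowBlocks_length (p k : ℕ) :
    slowBlocks p (k + 1) - slowBlocks p k = slowBlocks p k / p + 1 := by
  rw [slowBlocks_succ, add_assoc, Nat.add_sub_cancel_left]

theorem two_mul_slowBlocks_le {p : ℕ} (hp : 0 < p) (k : ℕ) :
    2 * slowBlocks p k ≤ slowBlocks p (k + p) := by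
  have h : ∀ j, slowBlocks p k + j * (slowBlocks p k / p + 1) ≤ slowBlocks p (k + j) := by
    intro j
    induction j with
    | zero => simp
    | succ j ih =>
      rw [← add_assoc, slowBlocks_succ]
      have := Nat.div_le_div_right (c := p)
        ((strictMono_slowBlocks p).monotone (Nat.le_add_right k j))
      rw [add_mul, one_mul]
      omega
  have h1 := h p
  have h2 := Nat.lt_mul_div_succ (slowBlocks p k) hp
  omega

theorem two_pow_le_slowBlocks {p : ℕ} (hp : 0 < p) (j : ℕ) :
    2 ^ j ≤ slowBlocks p (p * (j + 1)) := by
  induction j with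
  | zero =>
    have h1 : slowBlocks p 1 = 1 := by simp [slowBlocks]
    refine h1.symm.le.trans ((strictMono_slowBlocks p).monotone ?_)
    rw [zero_add, mul_one]
    exact hp
  | succ j ih =>
    have := two_mul_slowBlocks_le hp (p * (j + 1))
    rw [pow_succ', mul_add _ (j + 1), mul_one]
    omega

/-- If `Y` agrees with `Z` on more than the fraction `1 / 2 + 3 / p` of infinitely many initial
segments, then it agrees with `Z` on the fraction `1 / 2 + 1 / p` of infinitely many blocks. -/
theorem frequently_blockAgree {p : ℕ} (hp : 0 < p) {Y Z : ℕ → Bool}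
    (h : ∃ᶠ n in atTop, (1 / 2 + 3 / p : ℝ) * n < agreeCount Y Z n) :
    ∃ᶠ k in atTop, (p + 2) * (slowBlocks p (k + 1) - slowBlocks p k) ≤
      2 * p * blockAgree (slowBlocks p) Y Z k := by
  by_contra hno
  rw [not_frequently] at hno
  obtain ⟨k₀, hk₀⟩ := eventually_atTop.1 hno
  have hbm := strictMono_slowBlocks p
  set b := slowBlocks p with hb
  have hpre : ∀ k, k₀ ≤ k →
      2 * p * agreeCount Y Z (b k) ≤ 2 * p * b k₀ + (p + 2) * b k := by
    intro k hk
    induction k, hk using Nat.le_induction with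
    | base =>
      have := Nat.mul_le_mul_left (2 * p) (agreeCount_le Y Z (b k₀))
      omega
    | succ k hk ih =>
      have h1 := hk₀ k hk
      rw [not_le] at h1
      rw [agreeCount_block_succ hbm]
      have h2 := Nat.add_sub_cancel' (hbm (Nat.lt_succ_self k)).le
      have h3 : (p + 2) * b (k + 1) = (p + 2) * b k + (p + 2) * (b (k + 1) - b k) := by
        rw [← mul_add, h2]
      rw [mul_add]
      omega
  have hall : ∀ n, b k₀ ≤ n → 2 * p * agreeCount Y Z n ≤ 2 * p * b k₀ + (p + 4) * n + 2 * p := by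
    intro n hn
    -- the last block boundary not beyond `n`
    obtain ⟨k, hk, hkn, hnk⟩ : ∃ k, k₀ ≤ k ∧ b k ≤ n ∧ n < b (k + 1) := by
      have hle : k₀ ≤ n := hbm.le_apply.trans hn
      refine ⟨Nat.findGreatest (fun k => b k ≤ n) n,
        Nat.le_findGreatest hle hn, Nat.findGreatest_spec (P := fun k => b k ≤ n) hle hn, ?_⟩
      by_contra! hc
      have := Nat.le_findGreatest (P := fun k => b k ≤ n) (hbm.le_apply.trans hc) hc
      omega
    obtain ⟨i, rfl⟩ := Nat.exists_eq_add_of_le hkn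
    have h1 := hpre k hk
    have h2 : i ≤ b k / p := by
      have := slowBlocks_length p k
      rw [← hb] at this
      omega
    have h3 : p * i ≤ b k := (Nat.mul_le_mul_left p h2).trans (Nat.mul_div_le _ _)
    rw [agreeCount_add]
    have h4 := agreeCount_le (fun j => Y (b k + j)) (fun j => Z (b k + j)) i
    nlinarith
  obtain ⟨n, hn, hnc⟩ := (h.and_eventually
    (eventually_ge_atTop (b k₀ + (2 * p * b k₀ + 2 * p)))).exists
  have h1 := hall n (by omega)
  have hp' : (0 : ℝ) < p := by exact_mod_cast hp
  have h2 := mul_lt_mul_of_pos_left hn (by positivity : (0 : ℝ) < 2 * p)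
  have e : 2 * (p : ℝ) * ((1 / 2 + 3 / p) * n) = (p + 6) * n := by
    field_simp
    ring
  rw [e] at h2
  have h2' : (p + 6) * n < 2 * p * agreeCount Y Z n := by exact_mod_cast h2
  nlinarith

/-- If `X` computes a sequence of `γ`-value below `1 / 2`, then it computes an infinitely often
equal function: applied to complements, the hypothesis says that the sequence agrees with each
computable sequence on more than half of infinitely many blocks, so list decoding of its blocks
gives a trace of bounded size that catches each computable function infinitely often. -/
theorem exists_infinitelyOftenEqual_of_GammaValue_lt {X : ℕ → Bool} (h : GammaValue X < 1 / 2) :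
    ∃ f : ℕ → ℕ, Computes X f ∧ InfinitelyOftenEqual (fun n => 2 ^ (2 ^ n)) f := by
  obtain ⟨_, ⟨Y, hYX, rfl⟩, hY⟩ := exists_lt_of_csInf_lt (nonempty_gammaValues X) h
  obtain ⟨p, hp, hpY⟩ : ∃ p : ℕ, 0 < p ∧ gammaValue Y < 1 / 2 - 3 / p := by
    obtain ⟨n, hn⟩ := exists_nat_one_div_lt (show (0 : ℝ) < (1 / 2 - gammaValue Y) / 3 by linarith)
    refine ⟨n + 1, by omega, ?_⟩
    have : (3 : ℝ) / (n + 1 : ℕ) = 3 * (1 / (n + 1)) := by push_cast; ring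
    rw [this]
    linarith
  obtain ⟨q, L, hq, hL, W, hW, hWL⟩ := exists_listDecodable hp
  have hbc := computable_slowBlocks p
  have hbm := strictMono_slowBlocks p
  set b := slowBlocks p with hb
  have hN : Computable fun k => b (k + 1) - b k := computable_blockLength hbc
  have hB : Computable fun k => 2 ^ ((b (k + 1) - b k) / (q * L)) :=
    computable_pow.comp (.const 2) (Primrec.nat_div.to_comp.comp hN (.const _))
  obtain ⟨f, hfX, hf⟩ : ∃ f : ℕ → ℕ, Computes X f ∧
      InfinitelyOftenEqual (fun k => 2 ^ ((b (k + 1) - b k) / (q * L))) f := by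
    refine exists_infinitelyOftenEqual_of_trace (h := fun k => 2 ^ ((b (k + 1) - b k) / q)) hB
      (fun k => by positivity) (fun k => ?_)
      (computableIn_decodeList p q hW hbc hYX) (fun k => hWL _ _) fun g hg hgh => ?_
    · rw [← pow_mul, ← Nat.div_div_eq_div_mul]
      exact Nat.pow_le_pow_right (by norm_num) (Nat.div_mul_le_self _ _)
    · obtain ⟨Z, hZ, hZW⟩ := exists_concat hbc hbm rfl (computableIn_empty_iff.2 (hW.comp hN hg))
      have hZc := computableIn_empty_iff.1 hZ
      have hlow : lowerDensity (agreement Y fun i => !Z i) < 1 / 2 - 3 / p :=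
        (lowerDensity_le_gammaValue Y (Primrec.not.to_comp.comp hZc)).trans_lt hpY
      refine (frequently_blockAgree hp ((frequently_of_lowerDensity_lt hlow).mono
        fun n hn => ?_)).mono fun k hk =>
          mem_decodeList.2 ⟨hgh k, (close_blockCode_iff (hZW k)).2 hk⟩
      have hsum : (agreeCount Y (fun i => !Z i) n : ℝ) + agreeCount Y Z n = n := by
        exact_mod_cast agreeCount_not_add Y Z n
      linarith
  refine exists_infinitelyOftenEqual_of_le (h' := fun m => 2 ^ (2 ^ m))
    (h := fun k => 2 ^ ((b (k + 1) - b k) / (q * L)))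
    (a := p * (q * L * p + 1)) (by positivity)
    (computable_pow.comp (.const 2) (computable_pow.comp (.const 2) .id))
    (fun m => by positivity) (fun m r _ => Nat.pow_le_pow_right (by norm_num) ?_) hfX hf
  -- `p` steps double the boundaries, so `p * (C + 1)` steps per argument make the block length,
  -- even after division by `q * L`, grow at least like `2 ^ m`
  set C := q * L * p with hC
  have h1 : 2 ^ (C * m + C + m) ≤ b (p * (C + 1) * (m + 1) + r) := by
    refine (two_pow_le_slowBlocks hp (C * m + C + m)).trans (hbm.monotone ?_)
    have : p * (C * m + C + m + 1) = p * (C + 1) * (m + 1) := by ring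
    omega
  have h2 : C * 2 ^ m ≤ 2 ^ (C * m + C + m) := by
    rw [pow_add]
    exact Nat.mul_le_mul_right _
      (Nat.lt_two_pow_self.le.trans (Nat.pow_le_pow_right (by norm_num) (by omega)))
  rw [Nat.le_div_iff_mul_le (by positivity), slowBlocks_length]
  refine Nat.le_succ_of_le ((Nat.le_div_iff_mul_le hp).2 ?_)
  calc 2 ^ m * (q * L) * p = C * 2 ^ m := by rw [hC]; ring
    _ ≤ _ := h2.trans h1

theorem mainTheorem2 :
    (∀ (α : ℝ) (X : ℕ → Bool), 1 / 2 < α → α < 1 → GammaValue X < 1 - α →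
      (∃ f : ℕ → ℕ, Computes X f ∧ InfinitelyOftenEqual (fun n => 2 ^ (2 ^ n)) f) ∧
        GammaValue X = 0) ∧
    (∀ X : ℕ → Bool, GammaValue X = 0 ∨ GammaValue X = 1 / 2 ∨ GammaValue X = 1) := by
  refine ⟨fun α X h1 _ h3 => ?_, fun X => ?_⟩
  · obtain ⟨f, hfX, hf⟩ := exists_infinitelyOftenEqual_of_GammaValue_lt (X := X) (by linarith)
    exact ⟨⟨f, hfX, hf⟩, GammaValue_eq_zero hfX hf⟩
  · rcases lt_or_ge (GammaValue X) (1 / 2) with h | h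
    · obtain ⟨f, hfX, hf⟩ := exists_infinitelyOftenEqual_of_GammaValue_lt h
      exact .inl (GammaValue_eq_zero hfX hf)
    · by_cases hX : Computable X
      · exact .inr (.inr (GammaValue_eq_one hX))
      · refine .inr (.inl (le_antisymm (le_of_forall_pos_le_add fun ε hε => ?_) h))
        obtain ⟨n, hn⟩ := exists_nat_one_div_lt (show (0 : ℝ) < ε / 2 by linarith)
        refine (GammaValue_le_of_not_computable hX (p := n + 1) (by omega)).trans ?_
        have : (2 : ℝ) / (n + 1 : ℕ) = 2 * (1 / (n + 1)) := by push_cast; ring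
        rw [this]
        linarith
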